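/- Let $R$ be a commutative noetherian local ring with residue field $k$, let $\operatorname{mod} R$ be the category of finitely generated $R$-modules, and let $\operatorname{depth} R$ be the supremum of the lengths of the $R$-regular sequences in the maximal ideal of $R$. Subcategories of $\operatorname{mod} R$ are full and closed under isomorphisms. For a subcategory $\mathsf S$ of $\operatorname{mod} R$: - $\langle \mathsf S\rangle$ denotes the smallest subcategory of $\operatorname{mod} R$ that contains $\mathsf S\cup\{0\}$ and is closed under extensions and direct summands; - $\operatorname{cosyz}\mathsf S$ denotes the subcategory of the modules $X$ for which there is an exact sequence $0\to N\to P\to X\to 0$ with $N$ in $\mathsf S$ and $P$ finitely generated and projective; - $\mathfrak T_{-1}(\mathsf S)=\langle \mathsf S\rangle$, $\ \mathfrak T_0(\mathsf S)=\langle \mathsf S\cup\operatorname{cosyz}\langle \mathsf S\rangle\rangle$, and $\mathfrak T_n(\mathsf S)=\langle \mathfrak T_{n-1}(\mathsf S)\cup\operatorname{cosyz}\mathfrak T_{n-1}(\mathsf S)\rangle$ for $n\ge 1$. Let $\mathsf{FL}(R)$ be the subcategory of the modules of finite length and, for $n\ge -1$, let $\mathsf{PD}_n(R)$ be the subcategory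 of the finitely generated modules of projective dimension at most $n$, where $\mathsf{PD}_{-1}(R)=\{0\}$. **Theorem.** For every integer $n$ with $-1\le n\le \operatorname{depth} R-1$ there are equalities of subcategories of $\operatorname{mod} R$ $$\mathfrak T_n(\{k\})=\langle \mathsf{FL}(R)\cup\mathsf{PD}_n(R)\rangle=\langle \{k\}\cup\mathsf{PD}_n(R)\rangle .$$ For every integer $n$ with $-1\le n\le \operatorname{depth} R-2$, a finitely generated $R$-module $M$ belongs to $\mathfrak T_n(\{k\})$ if and only if there are finitely generated $R$-modules $M'$, $L$, $P$ with $L$ in $\mathsf{FL}(R)$ and $P$ in $\mathsf{PD}_n(R)$, and an exact sequence $$0\to L\to M\oplus M'\to P\to 0 .$$ -/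

import Mathlib

open CategoryTheory

universe u

namespace Tiers

variable {R : Type u} [CommRing R]

/-- `0 → X → Y → Z → 0` is a short exact sequence of `R`-modules. -/
structure IsShortExact {X Y Z : Type u} [AddCommGroup X] [Module R X] [AddCommGroup Y] [Module R Y]
    [AddCommGroup Z] [Module R Z] (f : X →ₗ[R] Y) (g : Y →ₗ[R] Z) : Prop where
  injective : Function.Injective f
  exact : Function.Exact f g
  surjective : Function.Surjective g

/-- The smallest full subcategory of `mod R` that contains `S` and `0` and is closed under
extensions and direct summands. Closure under isomorphisms is the case of `summand` in which
`p` and `i` are mutually inverse. -/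
inductive Closure (S : ObjectProperty (FGModuleCat.{u} R)) : ObjectProperty (FGModuleCat.{u} R)
  | of (X : FGModuleCat.{u} R) (hX : S X) : Closure S X
  | zero (X : FGModuleCat.{u} R) (hX : Subsingleton X) : Closure S X
  | extension {X Y Z : FGModuleCat.{u} R} (f : X →ₗ[R] Y) (g : Y →ₗ[R] Z)
      (h : IsShortExact f g) (hX : Closure S X) (hZ : Closure S Z) : Closure S Y
  | summand {X Y : FGModuleCat.{u} R} (i : X →ₗ[R] Y) (p : Y →ₗ[R] X)
      (h : p ∘ₗ i = LinearMap.id) (hY : Closure S Y) : Closure S X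

/-- The cosyzygies of modules in `S`: the modules `X` that fit into an exact sequence
`0 → N → P → X → 0` with `N` in `S` and `P` finitely generated and projective. -/
def Cosyz (S : ObjectProperty (FGModuleCat.{u} R)) : ObjectProperty (FGModuleCat.{u} R) :=
  fun X ↦ ∃ (N P : FGModuleCat.{u} R) (f : N →ₗ[R] P) (g : P →ₗ[R] X),
    S N ∧ Module.Projective R P ∧ IsShortExact f g

/-- The tiers of `S`, with index shifted by one: `tierAux S m` is the tier of index `m - 1`. -/
def tierAux (S : ObjectProperty (FGModuleCat.{u} R)) : ℕ → ObjectProperty (FGModuleCat.{u} R)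
  | 0 => Closure S
  | 1 => Closure (S ⊔ Cosyz (Closure S))
  | m + 2 => Closure (tierAux S (m + 1) ⊔ Cosyz (tierAux S (m + 1)))

/-- The `n`-th tier of `S`, for an integer `n ≥ -1`. -/
def tier (S : ObjectProperty (FGModuleCat.{u} R)) (n : ℤ) : ObjectProperty (FGModuleCat.{u} R) :=
  tierAux S (n + 1).toNat

variable (R)

/-- The finitely generated `R`-modules of projective dimension at most `n`, for an integer
`n ≥ -1`; the zero module is the only module of projective dimension at most `-1`.
(`HasProjectiveDimensionLT X m` says that `Ext X Y i = 0` for all `Y` and all `i ≥ m`.) -/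
def PD (n : ℤ) : ObjectProperty (FGModuleCat.{u} R) :=
  fun X ↦ HasProjectiveDimensionLT X.obj (n + 1).toNat

/-- The `R`-modules of finite length. -/
def FL : ObjectProperty (FGModuleCat.{u} R) :=
  fun X ↦ IsFiniteLength R X

/-- The full subcategory with the single object `k`, the residue field, up to isomorphism. -/
def residueField [IsLocalRing R] : ObjectProperty (FGModuleCat.{u} R) :=
  fun X ↦ Nonempty (X ≃ₗ[R] IsLocalRing.ResidueField R)

/-- The depth of a local ring: the supremum of the lengths of the `R`-regular sequences in the
maximal ideal. -/
noncomputable def depth [IsLocalRing R] : ℕ∞ :=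
  sSup {d : ℕ∞ | ∃ rs : List R, (∀ r ∈ rs, r ∈ IsLocalRing.maximalIdeal R) ∧
    RingTheory.Sequence.IsRegular R rs ∧ d = rs.length}

end Tiers

/-! Write `m = n + 1`. Everything rests on one fact: if `m ≤ depth R`, then `Extⁱ(L, R) = 0` for `L`
of finite length and `i < m` (`ExtVanishes`). By dimension shifting, `Extⁱ(L, P) = 0` whenever `pd P
< m` and `m + i ≤ depth R`.

For `i = 1` this lets a finite length module on top of a module of finite projective dimension be
moved to the bottom, so the modules that are finite length by `pd < m` are closed under extensions
(`IsFLByPD.of_isShortExact`). Allowing a complement `M'` takes care of direct summands and gives the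
second claim, for `m + 1 ≤ depth R`.

The first claim is an induction on `m`. If `N` in the closure embeds into a projective module, then
the finite length part of `N ⊕ N'` maps to zero in `N`, because `Hom(L, P) = 0`. Hence `N` is a
retract of a module with `pd < m`, and its cosyzygies have `pd < m + 1`. Conversely, modules with
`pd < m + 1` are cosyzygies of modules with `pd < m`. -/

namespace Tiers

open CategoryTheory Abelian

/-! ### Short exact sequences -/

section ShortExact

variable {R : Type u} [CommRing R] {X Y Z : Type u} [AddCommGroup X] [Module R X]
  [AddCommGroup Y] [Module R Y] [AddCommGroup Z] [Module R Z]

theorem IsShortExact.shortExact {f : X →ₗ[R] Y} {g : Y →ₗ[R] Z} (h : IsShortExact f g) :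
    (ModuleCat.shortComplexOfCompEqZero f g h.exact.linearMap_comp_eq_zero).ShortExact :=
  ModuleCat.shortComplex_shortExact _ h.exact h.injective h.surjective

theorem isShortExact_subtype_ker {g : Y →ₗ[R] Z} (hg : Function.Surjective g) :
    IsShortExact (LinearMap.ker g).subtype g :=
  ⟨Subtype.val_injective, g.exact_subtype_ker_map, hg⟩

/-- A short exact sequence with vanishing `Ext¹` between its outer terms splits. -/
theorem IsShortExact.exists_section {f : X →ₗ[R] Y} {g : Y →ₗ[R] Z} (h : IsShortExact f g)
    (hE : Subsingleton (Ext (ModuleCat.of R Z) (ModuleCat.of R X) 1)) :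
    ∃ s : Z →ₗ[R] Y, g ∘ₗ s = LinearMap.id := by
  obtain ⟨φ, hφ⟩ := Ext.covariant_sequence_exact₃ _ h.shortExact
    (Ext.mk₀ (𝟙 (ModuleCat.of R Z))) (zero_add 1) (hE.elim _ _)
  obtain ⟨φ, rfl⟩ := Ext.homEquiv₀.symm.surjective φ
  have h2 : φ ≫ (ModuleCat.ofHom g) = 𝟙 (ModuleCat.of R Z) :=
    Ext.homEquiv₀.symm.injective (by simpa using hφ)
  exact ⟨φ.hom, by simpa using congrArg ModuleCat.Hom.hom h2⟩

theorem isFiniteLength_of_isShortExact {f : X →ₗ[R] Y} {g : Y →ₗ[R] Z} (h : IsShortExact f g)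
    (hX : IsFiniteLength R X) (hZ : IsFiniteLength R Z) : IsFiniteLength R Y := by
  rw [← Module.length_ne_top_iff] at *
  rw [Module.length_eq_add_of_exact f g h.injective h.surjective h.exact]
  exact WithTop.add_ne_top.2 ⟨hX, hZ⟩

end ShortExact

/-! ### Vanishing of `Ext` from modules of finite length -/

section FiniteLength

variable {R : Type u} [CommRing R]

/-- `Extⁱ(L, R) = 0` for all `R`-modules `L` of finite length and all `i < d`. -/
def ExtVanishes (R : Type u) [CommRing R] (d : ℕ) : Prop :=
  ∀ (L : Type u) [AddCommGroup L] [Module R L], IsFiniteLength R L → ∀ i < d,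
    Subsingleton (Ext (ModuleCat.of R L) (ModuleCat.of R R) i)

/-- Induction along a composition series: a simple quotient is supported at the maximal ideal, where
a regular sequence kills `Ext` in low degrees, and the long exact sequence does the rest. -/
theorem extVanishes_of_isRegular [IsNoetherianRing R] [IsLocalRing R] {rs : List R}
    (hm : ∀ r ∈ rs, r ∈ IsLocalRing.maximalIdeal R) (hr : RingTheory.Sequence.IsRegular R rs) :
    ExtVanishes R rs.length := by
  intro L _ _ hL i hi
  induction hL with
  | of_subsingleton =>
    rename_i M _ _ _
    have : HasProjectiveDimensionLT (ModuleCat.of R M) 0 :=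
      (ModuleCat.isZero_of_subsingleton _).hasProjectiveDimensionLT_zero
    exact HasProjectiveDimensionLT.subsingleton _ 0 i (Nat.zero_le _) _
  | of_simple_quotient hN ih =>
    rename_i M _ _ N _
    have hs : IsShortExact N.subtype N.mkQ :=
      ⟨N.injective_subtype, LinearMap.exact_subtype_mkQ N, N.mkQ_surjective⟩
    have hQ : Subsingleton (Ext (ModuleCat.of R (M ⧸ N)) (ModuleCat.of R R) i) := by
      refine ModuleCat.subsingleton_ext_of_exists_isRegular (IsLocalRing.maximalIdeal R)
        (ModuleCat.of R (M ⧸ N)) ?_ (ModuleCat.of R R) ?_ rs hm hr i hi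
      · rw [Module.support_eq_zeroLocus]
        refine PrimeSpectrum.zeroLocus_anti_mono ?_
        have : (Module.annihilator R (M ⧸ N)).IsMaximal := IsSimpleModule.annihilator_isMaximal
        rw [IsLocalRing.eq_maximalIdeal this]
      · simpa using lt_top_iff_ne_top.2 (IsLocalRing.maximalIdeal.isMaximal R).ne_top
    refine subsingleton_of_forall_eq 0 fun x ↦ ?_
    obtain ⟨y, rfl⟩ := Ext.contravariant_sequence_exact₂ hs.shortExact _ x (ih.elim _ _)
    rw [hQ.elim y 0, Ext.comp_zero]

theorem extVanishes_of_le_depth [IsNoetherianRing R] [IsLocalRing R] {m : ℕ}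
    (h : (m : ℕ∞) ≤ depth R) : ExtVanishes R m := by
  obtain _ | m := m
  · exact fun _ _ _ _ i hi ↦ absurd hi (Nat.not_lt_zero i)
  -- The strict inequality yields a regular sequence of length at least `m + 1`, whether or not the
  -- supremum is attained.
  · have h1 : (m : ℕ∞) < depth R := lt_of_lt_of_le (by exact_mod_cast Nat.lt_succ_self m) h
    obtain ⟨d, ⟨rs, hm, hr, rfl⟩, hd⟩ := lt_sSup_iff.1 h1
    have hd' : m < rs.length := by exact_mod_cast hd
    exact fun L _ _ hL i hi ↦ extVanishes_of_isRegular hm hr L hL i (by omega)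

theorem ExtVanishes.projective {d : ℕ} (h : ExtVanishes R d) {L P : Type u} [AddCommGroup L]
    [Module R L] [AddCommGroup P] [Module R P] [Module.Finite R P] [Module.Projective R P]
    (hL : IsFiniteLength R L) {i : ℕ} (hi : i < d) :
    Subsingleton (Ext (ModuleCat.of R L) (ModuleCat.of R P) i) := by
  obtain ⟨n, f, g, -, -, hfg⟩ := Module.Finite.exists_comp_eq_id_of_projective R P
  refine subsingleton_of_forall_eq 0 fun x ↦ ?_
  -- `P` is a retract of `Rⁿ`, so its identity is a sum of `n` maps that factor through `R`.
  have hid : 𝟙 (ModuleCat.of R P) = ∑ j : Fin n,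
      ModuleCat.ofHom (LinearMap.proj j ∘ₗ g) ≫
        ModuleCat.ofHom (f ∘ₗ LinearMap.single R (fun _ ↦ R) j) := by
    ext p
    simp only [ModuleCat.hom_sum, ModuleCat.hom_comp, LinearMap.sum_apply]
    have := LinearMap.congr_fun hfg p
    simp only [LinearMap.comp_apply, LinearMap.id_apply] at this
    simp [← map_sum, Finset.univ_sum_single, this]
  rw [← x.comp_mk₀_id, hid, Ext.mk₀_sum, Ext.comp_sum]
  refine Finset.sum_eq_zero fun j _ ↦ ?_
  rw [← Ext.mk₀_comp_mk₀, ← Ext.comp_assoc_of_third_deg_zero,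
    (h L hL i hi).elim (x.comp _ _) 0, Ext.zero_comp]

/-- Dimension shifting: for `0 → K → Rⁿ → P → 0`, the group `Extⁱ(L, P)` sits between `Extⁱ(L, Rⁿ)`
and `Extⁱ⁺¹(L, K)`; passing to `K` preserves `m + i`. -/
theorem ExtVanishes.hasProjectiveDimensionLT [IsNoetherianRing R] {d : ℕ} (h : ExtVanishes R d)
    {L : Type u} [AddCommGroup L] [Module R L] (hL : IsFiniteLength R L) {m i : ℕ}
    (hmi : m + i ≤ d) {P : Type u} [AddCommGroup P] [Module R P] [Module.Finite R P]
    (hP : HasProjectiveDimensionLT (ModuleCat.of R P) m) :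
    Subsingleton (Ext (ModuleCat.of R L) (ModuleCat.of R P) i) := by
  induction m generalizing i P with
  | zero =>
    have := (isZero_of_hasProjectiveDimensionLT_zero (ModuleCat.of R P))
    refine subsingleton_of_forall_eq 0 fun x ↦ ?_
    rw [← x.comp_mk₀_id, this.eq_of_src (𝟙 _) 0, Ext.mk₀_zero, Ext.comp_zero]
  | succ m ih =>
    obtain _ | m := m
    · have : Module.Projective R P := (IsProjective.iff_projective P).2
        (projective_iff_hasProjectiveDimensionLT_one.2 hP)
      exact h.projective hL (by omega)
    · obtain ⟨n, g, hg⟩ := Module.Finite.exists_fin' R P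
      have hs := isShortExact_subtype_ker hg
      have hF : Projective (ModuleCat.of R (Fin n → R)) :=
        (IsProjective.iff_projective _).1 inferInstance
      have hK := (hs.shortExact.hasProjectiveDimensionLT_X₃_iff m hF).1 hP
      have h1 := ih (i := i + 1) (by omega) hK
      have h2 := h.projective (P := Fin n → R) hL (i := i) (by omega)
      refine subsingleton_of_forall_eq 0 fun x ↦ ?_
      obtain ⟨y, rfl⟩ := Ext.covariant_sequence_exact₃ _ hs.shortExact x rfl (h1.elim _ _)
      rw [h2.elim y 0, Ext.zero_comp]

theorem ExtVanishes.linearMap_eq_zero {d : ℕ} (h : ExtVanishes R d) (hd : 0 < d)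
    {L P : Type u} [AddCommGroup L] [Module R L] [AddCommGroup P] [Module R P]
    [Module.Finite R P] [Module.Projective R P] (hL : IsFiniteLength R L) (f : L →ₗ[R] P) :
    f = 0 := by
  have := h.projective (P := P) hL hd
  have h2 : Subsingleton (L →ₗ[R] P) :=
    (Ext.addEquiv₀ (X := ModuleCat.of R L) (Y := ModuleCat.of R P)
      |>.trans ModuleCat.homAddEquiv).symm.subsingleton
  exact h2.elim _ _

end FiniteLength

/-! ### Extensions of modules of finite projective dimension by modules of finite length -/

section Extension

variable {R : Type u} [CommRing R]

/-- `M` is an extension of a module of projective dimension less than `m` by a module of finite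
length. -/
def IsFLByPD (R : Type u) [CommRing R] (m : ℕ) (M : Type u) [AddCommGroup M] [Module R M] :
    Prop :=
  ∃ (P : Type u) (_ : AddCommGroup P) (_ : Module R P) (g : M →ₗ[R] P),
    Function.Surjective g ∧ IsFiniteLength R (LinearMap.ker g) ∧
      HasProjectiveDimensionLT (ModuleCat.of R P) m

variable {m : ℕ} {X Y Z : Type u} [AddCommGroup X] [Module R X]
  [AddCommGroup Y] [Module R Y] [AddCommGroup Z] [Module R Z]

theorem hasProjectiveDimensionLT_of_subsingleton [Subsingleton X] :
    HasProjectiveDimensionLT (ModuleCat.of R X) m := by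
  have : HasProjectiveDimensionLT (ModuleCat.of R X) 0 :=
    (ModuleCat.isZero_of_subsingleton _).hasProjectiveDimensionLT_zero
  exact hasProjectiveDimensionLT_of_ge _ 0 m (Nat.zero_le _)

theorem IsFLByPD.of_isFiniteLength (h : IsFiniteLength R X) : IsFLByPD R m X :=
  ⟨PUnit, inferInstance, inferInstance, (0 : X →ₗ[R] PUnit.{u + 1}), fun _ ↦ ⟨0, rfl⟩,
    (LinearEquiv.ofTop _ LinearMap.ker_zero).symm.isFiniteLength h,
    hasProjectiveDimensionLT_of_subsingleton⟩

theorem IsFLByPD.of_hasProjectiveDimensionLT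
    (h : HasProjectiveDimensionLT (ModuleCat.of R X) m) : IsFLByPD R m X := by
  refine ⟨X, inferInstance, inferInstance, LinearMap.id, Function.surjective_id, ?_, h⟩
  rw [LinearMap.ker_id]
  exact .of_subsingleton

theorem IsFLByPD.congr (h : IsFLByPD R m X) (e : Y ≃ₗ[R] X) : IsFLByPD R m Y := by
  obtain ⟨P, _, _, g, hg, hk, hP⟩ := h
  refine ⟨P, _, _, g ∘ₗ e.toLinearMap, hg.comp e.surjective, ?_, hP⟩
  rw [LinearMap.ker_comp]
  exact (e.ofSubmodule' _).symm.isFiniteLength hk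

/-- An extension of an iterated extension by a module into which finite length modules have no
nontrivial `Ext¹`. -/
theorem IsFLByPD.of_isShortExact_of_hasProjectiveDimensionLT [IsNoetherianRing R]
    (hR : ExtVanishes R (m + 1)) [Module.Finite R X] {f : X →ₗ[R] Y} {g : Y →ₗ[R] Z}
    (h : IsShortExact f g) (hX : HasProjectiveDimensionLT (ModuleCat.of R X) m)
    (hZ : IsFLByPD R m Z) : IsFLByPD R m Y := by
  obtain ⟨P, _, _, q, hq, hk, hP⟩ := hZ
  -- `W` is an extension of the finite length module `ker q` by `X`. It splits because `Ext¹(ker q,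
  -- X) = 0`, so `ker q` lifts to a submodule of `Y`.
  let W : Submodule R Y := (LinearMap.ker q).comap g
  let g' : W →ₗ[R] LinearMap.ker q := g.restrict fun _ hx ↦ hx
  let f' : X →ₗ[R] W := f.codRestrict W fun x ↦ by simp [W, h.exact.apply_apply_eq_zero]
  have hs : IsShortExact f' g' := by
    refine ⟨fun a b hab ↦ h.injective (congrArg Subtype.val hab), fun y ↦ ?_, fun z ↦ ?_⟩
    · have h1 := h.exact y.1
      constructor
      · intro hy
        obtain ⟨x, hx⟩ := h1.1 (congrArg Subtype.val hy)
        exact ⟨x, Subtype.ext hx⟩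
      · rintro ⟨x, hx⟩
        exact Subtype.ext (h1.2 ⟨x, congrArg Subtype.val hx⟩)
    · obtain ⟨y, hy⟩ := h.surjective z.1
      exact ⟨⟨y, by simp [W, hy]⟩, Subtype.ext hy⟩
  obtain ⟨s, hs'⟩ := hs.exists_section (hR.hasProjectiveDimensionLT hk le_rfl hX)
  let t : LinearMap.ker q →ₗ[R] Y := W.subtype ∘ₗ s
  have hgt : ∀ z, g (t z) = z.1 := fun z ↦ congrArg Subtype.val (LinearMap.congr_fun hs' z)
  have ht : Function.Injective t := fun a b hab ↦ Subtype.ext (by rw [← hgt a, hab, hgt b])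
  have hle : LinearMap.range t ≤ LinearMap.ker (q ∘ₗ g) := by
    rintro _ ⟨z, rfl⟩
    simp [hgt]
  -- Modulo the lifted copy of `ker q`, what remains of `Y` is an extension of `P` by `X`.
  have hf2 : IsShortExact ((LinearMap.range t).mkQ ∘ₗ f) ((LinearMap.range t).liftQ _ hle) := by
    refine ⟨?_, ?_, ?_⟩
    · rw [← LinearMap.ker_eq_bot, LinearMap.ker_eq_bot']
      intro x hx
      obtain ⟨z, hz⟩ := (Submodule.Quotient.mk_eq_zero _).1 hx
      have : z.1 = 0 := by rw [← hgt z, hz, h.exact.apply_apply_eq_zero]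
      have hz0 : z = 0 := Subtype.ext this
      rw [hz0, map_zero] at hz
      exact h.injective (by rw [← hz, map_zero])
    · intro y
      obtain ⟨y, rfl⟩ := Submodule.mkQ_surjective _ y
      constructor
      · intro hy
        have hy' : q (g y) = 0 := hy
        obtain ⟨x, hx⟩ := (h.exact (y - t ⟨g y, hy'⟩)).1 (by rw [map_sub, hgt, sub_self])
        refine ⟨x, ?_⟩
        simp only [LinearMap.comp_apply, hx, map_sub]
        rw [sub_eq_self]
        exact (Submodule.Quotient.mk_eq_zero _).2 ⟨_, rfl⟩
      · rintro ⟨x, hx⟩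
        rw [← hx]
        simp [h.exact.apply_apply_eq_zero]
    · intro p
      obtain ⟨z, rfl⟩ := hq p
      obtain ⟨y, rfl⟩ := h.surjective z
      exact ⟨(LinearMap.range t).mkQ y, rfl⟩
  refine ⟨_, _, _, (LinearMap.range t).mkQ, Submodule.mkQ_surjective _, ?_,
    hf2.shortExact.hasProjectiveDimensionLT_X₂ m hX hP⟩
  rw [Submodule.ker_mkQ]
  exact (LinearEquiv.ofInjective t ht).isFiniteLength hk

/-- Dividing `X` and `Y` by the finite length part of `X` reduces to the case where the left term
has finite projective dimension; that part is then added back to the kernel. -/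
theorem IsFLByPD.of_isShortExact [IsNoetherianRing R]
    (hR : ExtVanishes R (m + 1)) [Module.Finite R X] {f : X →ₗ[R] Y} {g : Y →ₗ[R] Z}
    (h : IsShortExact f g) (hX : IsFLByPD R m X) (hZ : IsFLByPD R m Z) : IsFLByPD R m Y := by
  obtain ⟨P, _, _, q, hq, hk, hP⟩ := hX
  let K : Submodule R Y := (LinearMap.ker q).map f
  have hle : K ≤ LinearMap.ker g := by
    rintro _ ⟨x, -, rfl⟩
    simp [h.exact.apply_apply_eq_zero]
  have hle' : LinearMap.ker q ≤ LinearMap.ker (K.mkQ ∘ₗ f) := fun x hx ↦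
    (Submodule.Quotient.mk_eq_zero _).2 ⟨x, hx, rfl⟩
  let e : (X ⧸ LinearMap.ker q) ≃ₗ[R] P := q.quotKerEquivOfSurjective hq
  have hP' : HasProjectiveDimensionLT (ModuleCat.of R (X ⧸ LinearMap.ker q)) m :=
    hasProjectiveDimensionLT_of_iso e.symm.toModuleIso m
  have hs : IsShortExact ((LinearMap.ker q).liftQ _ hle') (K.liftQ g hle) := by
    refine ⟨?_, ?_, ?_⟩
    · rw [← LinearMap.ker_eq_bot, LinearMap.ker_eq_bot']
      intro x hx
      obtain ⟨x, rfl⟩ := Submodule.mkQ_surjective _ x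
      obtain ⟨x', hx', hxx⟩ := (Submodule.Quotient.mk_eq_zero _).1 hx
      rw [← h.injective hxx]
      exact (Submodule.Quotient.mk_eq_zero _).2 hx'
    · intro y
      obtain ⟨y, rfl⟩ := Submodule.mkQ_surjective _ y
      constructor
      · intro hy
        obtain ⟨x, rfl⟩ := (h.exact y).1 hy
        exact ⟨(LinearMap.ker q).mkQ x, rfl⟩
      · rintro ⟨x, hx⟩
        obtain ⟨x, rfl⟩ := Submodule.mkQ_surjective _ x
        rw [← hx]
        exact h.exact.apply_apply_eq_zero x
    · intro z
      obtain ⟨y, rfl⟩ := h.surjective z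
      exact ⟨K.mkQ y, rfl⟩
  obtain ⟨Q, _, _, p, hp, hpk, hQ⟩ :=
    IsFLByPD.of_isShortExact_of_hasProjectiveDimensionLT hR hs hP' hZ
  refine ⟨Q, _, _, p ∘ₗ K.mkQ, hp.comp K.mkQ_surjective, ?_, hQ⟩
  have hKle : K ≤ LinearMap.ker (p ∘ₗ K.mkQ) := fun y hy ↦ by
    have : K.mkQ y = 0 := (Submodule.Quotient.mk_eq_zero _).2 hy
    simp [this]
  -- The new kernel is an extension of `ker p` by `K`, both of finite length.
  have hs2 : IsShortExact (Submodule.inclusion hKle)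
      (K.mkQ.restrict (p := LinearMap.ker (p ∘ₗ K.mkQ)) (q := LinearMap.ker p) fun _ hy ↦ hy) := by
    refine ⟨Submodule.inclusion_injective _, fun y ↦ ⟨fun hy ↦ ?_, ?_⟩, fun z ↦ ?_⟩
    · exact ⟨⟨y.1, (Submodule.Quotient.mk_eq_zero _).1 (congrArg Subtype.val hy)⟩, rfl⟩
    · rintro ⟨x, rfl⟩
      exact Subtype.ext ((Submodule.Quotient.mk_eq_zero _).2 x.2)
    · obtain ⟨y, hy⟩ := K.mkQ_surjective z.1
      exact ⟨⟨y, by simp only [LinearMap.mem_ker, LinearMap.comp_apply, hy]; exact z.2⟩,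
        Subtype.ext hy⟩
  exact isFiniteLength_of_isShortExact hs2
    ((Submodule.equivMapOfInjective f h.injective _).isFiniteLength hk) hpk

end Extension

/-! ### Closures under extensions and direct summands -/

section Closure

variable {R : Type u} [CommRing R]

theorem Closure.le_of_le {S T : ObjectProperty (FGModuleCat.{u} R)} (h : S ≤ Closure T) :
    Closure S ≤ Closure T := by
  intro X hX
  induction hX with
  | of X hX => exact h X hX
  | zero X hX => exact .zero X hX
  | extension f g h _ _ hX hZ => exact .extension f g h hX hZ
  | summand i p h _ hY => exact .summand i p h hY

theorem Closure.mono {S T : ObjectProperty (FGModuleCat.{u} R)} (h : S ≤ T) :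
    Closure S ≤ Closure T :=
  le_of_le fun X hX ↦ .of X (h X hX)

theorem Closure.congr {S : ObjectProperty (FGModuleCat.{u} R)} {X Y : FGModuleCat.{u} R}
    (h : Closure S Y) (e : X ≃ₗ[R] Y) : Closure S X :=
  .summand e.toLinearMap e.symm.toLinearMap (by ext; simp) h

theorem closure_residueField_of_isFiniteLength [IsNoetherianRing R] [IsLocalRing R] {X : Type u}
    [AddCommGroup X] [Module R X] (h : IsFiniteLength R X) :
    ∀ _ : Module.Finite R X, Closure (residueField R) (FGModuleCat.of R X) := by
  induction h with
  | of_subsingleton => exact fun _ ↦ .zero _ ‹_›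
  | of_simple_quotient hN ih =>
    rename_i M _ _ N _
    intro _
    refine .extension (X := FGModuleCat.of R N) (Y := FGModuleCat.of R M)
      (Z := FGModuleCat.of R (M ⧸ N)) N.subtype N.mkQ
      ⟨N.injective_subtype, LinearMap.exact_subtype_mkQ N, N.mkQ_surjective⟩
      (ih inferInstance) (.of _ ?_)
    obtain ⟨I, hI, ⟨e⟩⟩ := isSimpleModule_iff_quot_maximal.1 ‹IsSimpleModule R (M ⧸ N)›
    rw [IsLocalRing.eq_maximalIdeal hI] at e
    exact ⟨e⟩

theorem FL_le_closure_residueField [IsNoetherianRing R] [IsLocalRing R] :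
    FL R ≤ Closure (residueField R) :=
  fun X hX ↦ closure_residueField_of_isFiniteLength (X := X) hX inferInstance

theorem residueField_le_FL [IsLocalRing R] : residueField R ≤ FL R := by
  rintro X ⟨e⟩
  have : IsSimpleModule R X :=
    isSimpleModule_iff_quot_maximal.2 ⟨IsLocalRing.maximalIdeal R, inferInstance, ⟨e⟩⟩
  exact isFiniteLength_iff_isNoetherian_isArtinian.2 ⟨inferInstance, inferInstance⟩

/-- The finitely generated modules of projective dimension less than `m`. -/
def PDLT (R : Type u) [CommRing R] (m : ℕ) : ObjectProperty (FGModuleCat.{u} R) :=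
  fun X ↦ HasProjectiveDimensionLT X.obj m

/-- The complement `M'` absorbs direct summands, for which `IsFLByPD` has no evident closure
property; extensions survive because complements can be added to a short exact sequence. -/
theorem exists_isFLByPD_of_closure [IsNoetherianRing R] {m : ℕ} (hR : ExtVanishes R (m + 1))
    {M : FGModuleCat.{u} R} (h : Closure (FL R ⊔ PDLT R m) M) :
    ∃ M' : FGModuleCat.{u} R, IsFLByPD R m (M × M') := by
  have key : ∀ X : FGModuleCat.{u} R, IsFLByPD R m X →
      ∃ M' : FGModuleCat.{u} R, IsFLByPD R m (X × M') := fun X hX ↦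
    ⟨FGModuleCat.of R PUnit, hX.congr
      (LinearEquiv.prodUnique : (X × PUnit.{u + 1}) ≃ₗ[R] X)⟩
  induction h with
  | of X hX =>
    obtain hX | hX := hX
    · exact key X (.of_isFiniteLength hX)
    · exact key X (.of_hasProjectiveDimensionLT hX)
  | zero X hX => exact key X (.of_isFiniteLength .of_subsingleton)
  | @extension X Y Z f g h _ _ hX hZ =>
    obtain ⟨X', hX⟩ := hX
    obtain ⟨Z', hZ⟩ := hZ
    -- The sequence used is `0 → X ⊕ X' → Y ⊕ X' ⊕ Z' → Z ⊕ Z' → 0`.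
    refine ⟨FGModuleCat.of R (X' × Z'), ?_⟩
    let f' : X × X' →ₗ[R] Y × (X' × Z') := f.prodMap (LinearMap.inl R X' Z')
    let g' : Y × (X' × Z') →ₗ[R] Z × Z' := g.prodMap (LinearMap.snd R X' Z')
    have hs : IsShortExact f' g' := by
      refine ⟨h.injective.prodMap (LinearMap.inl_injective (R := R) (M := X') (M₂ := Z')), ?_,
        h.surjective.prodMap (LinearMap.snd_surjective (R := R) (M := X') (M₂ := Z'))⟩
      rintro ⟨y, x', z'⟩
      have := h.exact y
      constructor
      · intro hy
        obtain ⟨hy1, hy2⟩ := Prod.ext_iff.1 hy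
        obtain ⟨x, hx⟩ := this.1 hy1
        exact ⟨(x, x'), Prod.ext hx (Prod.ext rfl hy2.symm)⟩
      · rintro ⟨⟨x, x''⟩, hx⟩
        obtain ⟨hx1, hx2⟩ := Prod.ext_iff.1 hx
        exact Prod.ext (this.2 ⟨x, hx1⟩) (Prod.ext_iff.1 hx2).2.symm
    exact IsFLByPD.of_isShortExact hR hs hX hZ
  | @summand X Y i p h _ hY =>
    obtain ⟨Y', hY⟩ := hY
    -- Since `p` splits, `Y ≅ X ⊕ ker p`.
    refine ⟨FGModuleCat.of R (LinearMap.ker p × Y'), ?_⟩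
    have hpi : ∀ x, p (i x) = x := LinearMap.congr_fun h
    let φ : X × (LinearMap.ker p × Y') →ₗ[R] Y × Y' :=
      (i ∘ₗ LinearMap.fst R _ _ + (LinearMap.ker p).subtype ∘ₗ LinearMap.fst R _ _ ∘ₗ
        LinearMap.snd R _ _).prod (LinearMap.snd R _ _ ∘ₗ LinearMap.snd R _ _)
    have hφ : Function.Bijective φ := by
      constructor
      · rw [← LinearMap.ker_eq_bot, LinearMap.ker_eq_bot']
        rintro ⟨x, k, y'⟩ hx
        obtain ⟨h1, h2⟩ := Prod.ext_iff.1 hx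
        have h1' : i x + k.1 = 0 := h1
        have hx0 : x = 0 := by
          have := congrArg p h1'
          rwa [map_add, hpi, LinearMap.mem_ker.1 k.2, add_zero, map_zero] at this
        subst hx0
        rw [map_zero, zero_add] at h1'
        exact Prod.ext rfl (Prod.ext (Subtype.ext h1') h2)
      · rintro ⟨y, y'⟩
        exact ⟨(p y, ⟨y - i (p y), by simp [hpi]⟩, y'), by simp [φ]⟩
    exact hY.congr (LinearEquiv.ofBijective φ hφ)

theorem closure_of_isShortExact_prod {m : ℕ} {M M' L P : FGModuleCat.{u} R}
    {f : L →ₗ[R] M × M'} {g : M × M' →ₗ[R] P} (hL : FL R L) (hP : PDLT R m P)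
    (h : IsShortExact f g) : Closure (FL R ⊔ PDLT R m) M :=
  .summand (Y := FGModuleCat.of R (M × M')) (LinearMap.inl R M M') (LinearMap.fst R M M')
    (LinearMap.fst_comp_inl R M M')
    (.extension (Y := FGModuleCat.of R (M × M')) f g h (.of _ (Or.inl hL)) (.of _ (Or.inr hP)))

theorem closure_iff_exists_isShortExact [IsNoetherianRing R] {m : ℕ}
    (hR : ExtVanishes R (m + 1)) (M : FGModuleCat.{u} R) :
    Closure (FL R ⊔ PDLT R m) M ↔
      ∃ (M' L P : FGModuleCat.{u} R) (f : L →ₗ[R] M × M') (g : M × M' →ₗ[R] P),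
        FL R L ∧ PDLT R m P ∧ IsShortExact f g := by
  refine ⟨fun h ↦ ?_, fun ⟨M', L, P, f, g, hL, hP, h⟩ ↦ closure_of_isShortExact_prod hL hP h⟩
  obtain ⟨M', P, _, _, g, hg, hk, hP⟩ := exists_isFLByPD_of_closure hR h
  have : Module.Finite R P := .of_surjective g hg
  exact ⟨M', FGModuleCat.of R (LinearMap.ker g), FGModuleCat.of R P, _, g, hk, hP,
    isShortExact_subtype_ker hg⟩

/-! ### Cosyzygies and the tiers -/

theorem PDLT.mono {m n : ℕ} (h : m ≤ n) : PDLT R m ≤ PDLT R n := fun X hX ↦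
  have : HasProjectiveDimensionLT X.obj m := hX
  hasProjectiveDimensionLT_of_ge _ m n h

/-- A module in the closure that embeds into a finite projective module has finite projective
dimension, provided that the depth is large enough. -/
theorem hasProjectiveDimensionLT_of_closure_of_injective [IsNoetherianRing R] {m : ℕ}
    (hR : ExtVanishes R (m + 1)) {N P : FGModuleCat.{u} R} [Module.Projective R P]
    (hN : Closure (FL R ⊔ PDLT R m) N) {f : N →ₗ[R] P} (hf : Function.Injective f) :
    HasProjectiveDimensionLT (ModuleCat.of R N) m := by
  obtain ⟨N', Q, _, _, g, hg, hk, hQ⟩ := exists_isFLByPD_of_closure hR hN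
  -- The composite `ker g → N × N' → N → P` is zero, so the projection to `N` factors through `Q`
  -- and makes `N` a retract of `Q`.
  have h0 := hR.linearMap_eq_zero (Nat.succ_pos m) hk
    (f ∘ₗ LinearMap.fst R N N' ∘ₗ (LinearMap.ker g).subtype)
  have hle : LinearMap.ker g ≤ LinearMap.ker (LinearMap.fst R N N') := fun x hx ↦
    hf (by rw [map_zero]; exact LinearMap.congr_fun h0 ⟨x, hx⟩)
  let r : Q →ₗ[R] N := (LinearMap.ker g).liftQ _ hle ∘ₗ
    (g.quotKerEquivOfSurjective hg).symm.toLinearMap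
  have hr : ∀ x, r (g x) = x.1 := fun x ↦ by
    have : (g.quotKerEquivOfSurjective hg).symm (g x) = (LinearMap.ker g).mkQ x := by
      rw [LinearEquiv.symm_apply_eq]; rfl
    simp only [r, LinearMap.comp_apply, LinearEquiv.coe_coe, this]
    rfl
  exact Retract.hasProjectiveDimensionLT (Y := ModuleCat.of R Q)
    { i := ModuleCat.ofHom (g ∘ₗ LinearMap.inl R N N')
      r := ModuleCat.ofHom r
      retract := by ext x; exact hr (x, 0) } m

theorem cosyz_closure_le_PDLT [IsNoetherianRing R] {m : ℕ} (hR : ExtVanishes R (m + 1)) :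
    Cosyz (Closure (FL R ⊔ PDLT R m)) ≤ PDLT R (m + 1) := by
  rintro X ⟨N, P, f, g, hN, hP, h⟩
  have hN' := hasProjectiveDimensionLT_of_closure_of_injective hR hN h.injective
  have hP' : Projective (ModuleCat.of R P) := (IsProjective.iff_projective _).1 hP
  have hP1 : HasProjectiveDimensionLT (ModuleCat.of R P) 1 :=
    projective_iff_hasProjectiveDimensionLT_one.1 hP'
  exact h.shortExact.hasProjectiveDimensionLT_X₃ m hN'
    (hasProjectiveDimensionLT_of_ge _ 1 (m + 1) (by omega))

theorem PDLT_succ_le_cosyz [IsNoetherianRing R] {m : ℕ} {S : ObjectProperty (FGModuleCat.{u} R)}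
    (hS : PDLT R m ≤ Closure S) : PDLT R (m + 1) ≤ Cosyz (Closure S) := by
  intro X hX
  have hX' : HasProjectiveDimensionLT (ModuleCat.of R X) (m + 1) := hX
  obtain _ | m := m
  -- Here `X` is projective, hence a cosyzygy of zero.
  · refine ⟨FGModuleCat.of R PUnit, X, 0, LinearMap.id, .zero _ inferInstanceAs (Subsingleton PUnit),
      (IsProjective.iff_projective X).2 (projective_iff_hasProjectiveDimensionLT_one.2 hX'),
      ⟨Function.injective_of_subsingleton (α := PUnit.{u + 1}) _, ?_, Function.surjective_id⟩⟩
    intro y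
    exact ⟨fun hy ↦ ⟨0, hy.symm⟩, fun ⟨_, hx⟩ ↦ hx.symm⟩
  · obtain ⟨n, g, hg⟩ := Module.Finite.exists_fin' R X
    have hs := isShortExact_subtype_ker hg
    have hF : Projective (ModuleCat.of R (Fin n → R)) :=
      (IsProjective.iff_projective _).1 inferInstance
    have hK := (hs.shortExact.hasProjectiveDimensionLT_X₃_iff m hF).1 hX'
    exact ⟨FGModuleCat.of R (LinearMap.ker g), FGModuleCat.of R (Fin n → R), _, g, hS _ hK,
      inferInstanceAs (Module.Projective R (Fin n → R)), hs⟩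

/-- Makes the recursion uniform: the tier of index `0` is built from `S` instead of its closure,
which does not change the result. -/
theorem tierAux_succ_eq (S : ObjectProperty (FGModuleCat.{u} R)) (m : ℕ) :
    tierAux S (m + 1) = Closure (tierAux S m ⊔ Cosyz (tierAux S m)) := by
  obtain _ | m := m
  · refine le_antisymm (Closure.mono (sup_le_sup_right (fun X hX ↦ .of X hX) _)) ?_
    refine Closure.le_of_le (sup_le (Closure.mono le_sup_left) fun X hX ↦ .of X (Or.inr hX))
  · rfl

/-- Vanishing below degree `m` suffices, since the step to `m + 1` takes cosyzygies only of the
closure at `m`. -/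
theorem tierAux_residueField_eq [IsNoetherianRing R] [IsLocalRing R] {m : ℕ}
    (hR : ExtVanishes R m) :
    tierAux (residueField R) m = Closure (FL R ⊔ PDLT R m) := by
  induction m with
  | zero =>
    refine le_antisymm (Closure.mono (residueField_le_FL.trans le_sup_left)) ?_
    refine Closure.le_of_le (sup_le FL_le_closure_residueField fun X hX ↦ .zero X ?_)
    exact ModuleCat.subsingleton_of_isZero
      ((hasProjectiveDimensionLT_zero_iff_isZero X.obj).1 hX)
  | succ m ih =>
    rw [tierAux_succ_eq, ih fun L _ _ hL i hi ↦ hR L hL i (by omega)]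
    apply le_antisymm
    · refine Closure.le_of_le (sup_le (Closure.mono (sup_le_sup_left (PDLT.mono (by omega)) _)) ?_)
      exact (cosyz_closure_le_PDLT hR).trans fun X hX ↦ .of X (Or.inr hX)
    · refine Closure.mono (sup_le (le_sup_of_le_left fun X hX ↦ .of X (Or.inl hX)) ?_)
      exact le_sup_of_le_right (PDLT_succ_le_cosyz fun X hX ↦ .of X (Or.inr hX))

end Closure

end Tiers

theorem mainTheorem3 {R : Type u} [CommRing R] [IsNoetherianRing R] [IsLocalRing R]
    (n : ℤ) (hn : -1 ≤ n) :
    (((n + 1).toNat : ℕ∞) ≤ Tiers.depth R →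
      Tiers.tier (Tiers.residueField R) n = Tiers.Closure (Tiers.FL R ⊔ Tiers.PD R n) ∧
      Tiers.Closure (Tiers.FL R ⊔ Tiers.PD R n) =
        Tiers.Closure (Tiers.residueField R ⊔ Tiers.PD R n)) ∧
    (((n + 2).toNat : ℕ∞) ≤ Tiers.depth R →
      ∀ M : FGModuleCat.{u} R, Tiers.tier (Tiers.residueField R) n M ↔
        ∃ (M' L P : FGModuleCat.{u} R) (f : L →ₗ[R] M × M') (g : M × M' →ₗ[R] P),
          Tiers.FL R L ∧ Tiers.PD R n P ∧ Tiers.IsShortExact f g) := by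
  -- The second claim needs one more vanishing degree than the first: it uses `Ext¹(L, P) = 0` for
  -- `P` of projective dimension at most `n` itself.
  have h2 : (n + 2).toNat = (n + 1).toNat + 1 := by omega
  refine ⟨fun h ↦ ⟨Tiers.tierAux_residueField_eq (Tiers.extVanishes_of_le_depth h), ?_⟩,
    fun h M ↦ ?_⟩
  · refine le_antisymm (Tiers.Closure.le_of_le (sup_le ?_ fun X hX ↦ .of X (Or.inr hX)))
      (Tiers.Closure.mono (sup_le_sup_right Tiers.residueField_le_FL _))
    exact Tiers.FL_le_closure_residueField.trans (Tiers.Closure.mono le_sup_left)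
  · rw [h2] at h
    have hR := Tiers.extVanishes_of_le_depth h
    have ht : Tiers.tier (Tiers.residueField R) n = _ :=
      Tiers.tierAux_residueField_eq fun L _ _ hL i hi ↦ hR L hL i (Nat.lt_succ_of_lt hi)
    rw [ht]
    exact Tiers.closure_iff_exists_isShortExact hR M
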